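/- Write ordinals $\alpha<\omega^\omega$ in Cantor normal form $\alpha=\omega^{n_0}+\dots+\omega^{n_{k-1}}$ with $n_0\ge\dots\ge n_{k-1}$ in $\mathbb{N}$. For $m\in\mathbb{N}$ put $0[m]=0$, $(\beta+1)[m]=\beta$, and $(\beta+\omega^{j})[m]=\beta+\omega^{j-1}\cdot m$ for $j\ge1$, where in both cases the last summand of the Cantor normal form is the one displayed. A finite set $X=\{x_0<\dots<x_{\ell-1}\}\subseteq\mathbb{N}$ is called $\alpha$-large if $\alpha[x_0][x_1]\cdots[x_{\ell-1}]=0$. Theorem. Let $n\in\mathbb{N}$ and let $X\subseteq\mathbb{N}$ be a finite set with $\min X\ge 3$ that is $\omega^{300n}$-large. Then for every colouring $P:[X]^2\to\{0,1\}$ of the two-element subsets of $X$ there is a set $Y\subseteq X$ that is $\omega^n$-large and $P$-homogeneous, i.e. $P$ is constant on $[Y]^2$. -/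

import Mathlib

namespace KetonenSolovay

/-- Ordinals `α < ω ^ ω` in Cantor normal form `α = ω ^ n₀ + ⋯ + ω ^ nₖ₋₁` with `n₀ ≥ ⋯ ≥ nₖ₋₁`.
The exponents are listed from the last (lowest) summand to the first, so `exps = [nₖ₋₁, …, n₀]`. -/
@[ext]
structure CNF where
  exps : List ℕ
  sorted : exps.Pairwise (· ≤ ·)

namespace CNF

/-- The ordinal `0`: the empty sum. -/
def zero : CNF := ⟨[], List.Pairwise.nil⟩

instance : Zero CNF := ⟨zero⟩

/-- The ordinal `ω ^ n`. -/
def omegaPow (n : ℕ) : CNF := ⟨[n], List.pairwise_singleton _ n⟩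

/-- The list of exponents of `α[m]`, where `0[m] = 0`, `(β + 1)[m] = β` and
`(β + ω ^ (n + 1))[m] = β + ω ^ n * m`. -/
def fundExps (m : ℕ) : List ℕ → List ℕ
  | [] => []
  | 0 :: l => l
  | (n + 1) :: l => List.replicate m n ++ l

theorem fundExps_sorted (m : ℕ) {l : List ℕ} (h : l.Pairwise (· ≤ ·)) :
    (fundExps m l).Pairwise (· ≤ ·) := by
  match l, h with
  | [], _ => exact List.Pairwise.nil
  | 0 :: l, h => exact (List.pairwise_cons.1 h).2
  | (n + 1) :: l, h =>
    obtain ⟨h1, h2⟩ := List.pairwise_cons.1 h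
    refine List.pairwise_append.2 ⟨?_, h2, ?_⟩
    · exact List.pairwise_replicate.2 (Or.inr le_rfl)
    · intro a ha b hb
      rw [List.eq_of_mem_replicate ha]
      exact (Nat.le_succ n).trans (h1 b hb)

/-- The fundamental sequence operation `α[m]`. -/
def fund (α : CNF) (m : ℕ) : CNF := ⟨fundExps m α.exps, fundExps_sorted m α.sorted⟩

end CNF

/-- A finite set `X = {x₀ < ⋯ < xₗ₋₁}` is `α`-large if `α[x₀]⋯[xₗ₋₁] = 0`. -/
def IsLarge (α : CNF) (X : Finset ℕ) : Prop :=
  (X.sort (· ≤ ·)).foldl CNF.fund α = 0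

/-- `Y` is homogeneous for the colouring `P : [X]^n → k` if `P` is constant on `[Y]^n`. -/
def IsHomogeneous {X : Finset ℕ} {n k : ℕ} (P : X.powersetCard n → Fin k) (Y : Finset ℕ) : Prop :=
  ∀ s t : X.powersetCard n, s.1 ⊆ Y → t.1 ⊆ Y → P s = P t

/-- `X` is `RT^n_k`-`α`-large: every colouring `P : [X]^n → k` has an `α`-large homogeneous set. -/
def IsRTLarge (n k : ℕ) (α : CNF) (X : Finset ℕ) : Prop :=
  ∀ P : X.powersetCard n → Fin k, ∃ Y ⊆ X, IsHomogeneous P Y ∧ IsLarge α Y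

end KetonenSolovay

/-!
Cutting a head of a hydra corresponds to passing from `α` to `α[x]`, the heads being the exponents
of `α`. Fundamental sequences always cut a smallest head, and no other strategy survives longer; so
if several ordinals are run in parallel, one for each colour of points, the hydra of their sum
bounds the whole process. This gives a pigeonhole principle: a colouring of an `ω ^ (n + 1)`-large
set with at most `min X` colours is constant on some `ω ^ n`-large subset.

Thin `X` to a set in which `x < y` implies `4 ^ x ≤ y`. There the pigeonhole principle can prescribe
the colours of all pairs formed with smaller elements at the cost of one exponent, and Ramsey's
theorem for blocks applies. At the cost of eight exponents one finds `x` followed by `x` large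
blocks, such that all pairs formed with `x` or between different blocks have the same colour `b`.
Now aim for an `ω ^ p₀`-large set of colour `0` or an `ω ^ p₁`-large set of colour `1`, by induction
on `p₀ + p₁`: lowering `p b` by one inside each block, either some block has a set of the other
colour, or the sets of colour `b` from all blocks, together with `x`, form one that is larger by one
exponent.
-/

namespace KetonenSolovay

/-! ### Large subsets as sequences of blocks -/

/-- The exponents of `α[x₀]⋯[xₗ₋₁]`, where `A` lists the exponents of `α` from the lowest to the
highest and `l = [x₀, …, xₗ₋₁]`. -/
def runExps (A l : List ℕ) : List ℕ := l.foldl (fun B x => CNF.fundExps x B) A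

@[simp] theorem runExps_nil_right (A : List ℕ) : runExps A [] = A := rfl

@[simp] theorem runExps_cons_right (A : List ℕ) (x : ℕ) (l : List ℕ) :
    runExps A (x :: l) = runExps (CNF.fundExps x A) l := rfl

@[simp] theorem runExps_nil_left (l : List ℕ) : runExps [] l = [] := by
  induction l with
  | nil => rfl
  | cons _ _ ih => simpa [CNF.fundExps] using ih

theorem runExps_append_right (A l₁ l₂ : List ℕ) :
    runExps A (l₁ ++ l₂) = runExps (runExps A l₁) l₂ := List.foldl_append

theorem exps_foldl_fund (α : CNF) (l : List ℕ) :
    (l.foldl CNF.fund α).exps = runExps α.exps l := by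
  induction l generalizing α with
  | nil => rfl
  | cons x _ ih => exact ih (α.fund x)

theorem isLarge_iff_runExps_eq_nil {α : CNF} {X : Finset ℕ} :
    IsLarge α X ↔ runExps α.exps (X.sort (· ≤ ·)) = [] := by
  rw [IsLarge, CNF.ext_iff, exps_foldl_fund]
  rfl

theorem fundExps_cons_append (x a : ℕ) (A B : List ℕ) :
    CNF.fundExps x (a :: (A ++ B)) = CNF.fundExps x (a :: A) ++ B := by
  cases a <;> simp [CNF.fundExps]

theorem exists_append_of_runExps_append_eq_nil {A B l : List ℕ} (h : runExps (A ++ B) l = []) :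
    ∃ l₁ l₂, l₁ ++ l₂ = l ∧ (∀ C, runExps (A ++ C) l₁ = C) ∧ runExps B l₂ = [] := by
  induction l generalizing A with
  | nil =>
    obtain ⟨rfl, rfl⟩ := List.append_eq_nil_iff.1 h
    exact ⟨[], [], rfl, fun _ => rfl, rfl⟩
  | cons x l ih =>
    cases A with
    | nil => exact ⟨[], x :: l, rfl, fun _ => rfl, h⟩
    | cons a A =>
      rw [List.cons_append, runExps_cons_right, fundExps_cons_append] at h
      obtain ⟨l₁, l₂, rfl, hA, hB⟩ := ih h
      refine ⟨x :: l₁, l₂, rfl, fun C => ?_, hB⟩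
      rw [List.cons_append, runExps_cons_right, fundExps_cons_append, hA]

/-- `X` contains an `α`-large subset, where `A` lists the exponents of `α` from the lowest to the
highest. Unlike `α`-largeness itself, this is visibly monotone in `X`. -/
def ContainsLarge (A : List ℕ) (X : Finset ℕ) : Prop :=
  ∃ l : List ℕ, l.Pairwise (· < ·) ∧ (∀ x ∈ l, x ∈ X) ∧ runExps A l = []

/-- Every element of `A` is smaller than every element of `B`. -/
def Precedes (A B : Finset ℕ) : Prop := ∀ x ∈ A, ∀ y ∈ B, x < y

/-- `f` is a sequence of successive subsets of `X`, its blocks. -/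
structure IsBlockSequence {k : ℕ} (f : Fin k → Finset ℕ) (X : Finset ℕ) : Prop where
  subset : ∀ i, f i ⊆ X
  precedes : ∀ i j, i < j → Precedes (f i) (f j)

section

variable {m n k : ℕ} {A B : List ℕ} {X Y : Finset ℕ} {f g : Fin k → Finset ℕ}

theorem Precedes.mono {X' Y' : Finset ℕ} (h : Precedes X Y) (hX : X' ⊆ X) (hY : Y' ⊆ Y) :
    Precedes X' Y' := fun x hx y hy => h x (hX hx) y (hY hy)

theorem IsBlockSequence.mono (h : IsBlockSequence f X) (hXY : X ⊆ Y) : IsBlockSequence f Y :=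
  ⟨fun i => (h.subset i).trans hXY, h.precedes⟩

theorem IsBlockSequence.refine (h : IsBlockSequence f X) (hgf : ∀ i, g i ⊆ f i) :
    IsBlockSequence g X :=
  ⟨fun i => (hgf i).trans (h.subset i), fun i j hij => (h.precedes i j hij).mono (hgf i) (hgf j)⟩

theorem IsBlockSequence.comp_strictMono (h : IsBlockSequence f X) {σ : Fin m → Fin k}
    (hσ : StrictMono σ) : IsBlockSequence (f ∘ σ) X :=
  ⟨fun i => h.subset (σ i), fun _ _ hij => h.precedes _ _ (hσ hij)⟩

theorem ContainsLarge.mono (h : ContainsLarge A X) (hXY : X ⊆ Y) : ContainsLarge A Y := by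
  obtain ⟨l, hl, hlX, hrun⟩ := h
  exact ⟨l, hl, fun x hx => hXY (hlX x hx), hrun⟩

theorem containsLarge_exps_iff {α : CNF} :
    ContainsLarge α.exps X ↔ ∃ Y ⊆ X, IsLarge α Y := by
  constructor
  · rintro ⟨l, hl, hlX, hrun⟩
    have hsort : l.toFinset.sort (· ≤ ·) = l :=
      (List.toFinset_sort (· ≤ ·) hl.sortedLT.nodup).2 (hl.imp le_of_lt)
    exact ⟨l.toFinset, fun x hx => hlX x (List.mem_toFinset.1 hx),
      isLarge_iff_runExps_eq_nil.2 (by rwa [hsort])⟩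
  · rintro ⟨Y, hYX, hY⟩
    exact ⟨Y.sort (· ≤ ·), Y.sortedLT_sort.pairwise,
      fun x hx => hYX ((Finset.mem_sort _).1 hx), isLarge_iff_runExps_eq_nil.1 hY⟩

theorem containsLarge_nil (X : Finset ℕ) : ContainsLarge [] X :=
  ⟨[], List.Pairwise.nil, by simp, rfl⟩

theorem containsLarge_append_iff :
    ContainsLarge (A ++ B) X ↔
      ∃ Y ⊆ X, ∃ Z ⊆ X, Precedes Y Z ∧ ContainsLarge A Y ∧ ContainsLarge B Z := by
  constructor
  · rintro ⟨l, hl, hlX, hrun⟩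
    obtain ⟨l₁, l₂, rfl, hA, hB⟩ := exists_append_of_runExps_append_eq_nil hrun
    obtain ⟨hl₁, hl₂, hlt⟩ := List.pairwise_append.1 hl
    refine ⟨l₁.toFinset, fun x hx => hlX x (by simp_all), l₂.toFinset,
      fun x hx => hlX x (by simp_all), fun x hx y hy => hlt x (by simpa using hx) y
      (by simpa using hy), ⟨l₁, hl₁, by simp, by simpa using hA []⟩, l₂, hl₂, by simp, hB⟩
  · rintro ⟨Y, hYX, Z, hZX, hYZ, ⟨l, hl, hlY, hrun⟩, l₂, hl₂, hlZ, hB⟩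
    have hrun' : runExps (A ++ []) l = [] := by rwa [List.append_nil]
    obtain ⟨l₁, l₁', rfl, hA, -⟩ := exists_append_of_runExps_append_eq_nil hrun'
    have hY : ∀ x ∈ l₁, x ∈ Y := fun x hx => hlY x (List.mem_append_left _ hx)
    refine ⟨l₁ ++ l₂, List.pairwise_append.2 ⟨(List.pairwise_append.1 hl).1, hl₂,
      fun x hx y hy => hYZ x (hY x hx) y (hlZ y hy)⟩, fun x hx => ?_, ?_⟩
    · exact (List.mem_append.1 hx).elim (fun hx => hYX (hY x hx)) fun hx => hZX (hlZ x hx)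
    · rw [runExps_append_right, hA, hB]

theorem containsLarge_replicate_iff :
    ContainsLarge (List.replicate k n) X ↔
      ∃ f : Fin k → Finset ℕ, IsBlockSequence f X ∧ ∀ i, ContainsLarge [n] (f i) := by
  induction k generalizing X with
  | zero => exact ⟨fun _ => ⟨Fin.elim0, ⟨fun i => i.elim0, fun i => i.elim0⟩, fun i => i.elim0⟩,
      fun _ => containsLarge_nil X⟩
  | succ k ih =>
    rw [List.replicate_succ, ← List.singleton_append, containsLarge_append_iff]
    constructor
    · rintro ⟨Y, hYX, Z, hZX, hYZ, hY, hZ⟩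
      obtain ⟨f, hf, hlarge⟩ := ih.1 hZ
      refine ⟨Fin.cons Y f, ⟨Fin.cases hYX fun i => (hf.subset i).trans hZX, ?_⟩,
        Fin.cases hY hlarge⟩
      refine Fin.cases (Fin.cases (fun h => absurd h (lt_irrefl _)) fun j _ => ?_)
        fun i => Fin.cases (fun h => absurd h (Fin.not_lt_zero _)) fun j hij => ?_
      · exact hYZ.mono subset_rfl (hf.subset j)
      · exact hf.precedes i j (Fin.succ_lt_succ_iff.1 hij)
    · rintro ⟨f, hf, hlarge⟩
      refine ⟨f 0, hf.subset 0, Finset.univ.biUnion fun i : Fin k => f i.succ,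
        Finset.biUnion_subset.2 fun i _ => hf.subset _, fun x hx y hy => ?_, hlarge 0,
        ih.2 ⟨fun i => f i.succ, ⟨fun i => Finset.subset_biUnion_of_mem (fun i : Fin k => f i.succ)
          (Finset.mem_univ i), fun i j hij => hf.precedes _ _ (Fin.succ_lt_succ_iff.2 hij)⟩,
          fun i => hlarge _⟩⟩
      obtain ⟨i, -, hy⟩ := Finset.mem_biUnion.1 hy
      exact hf.precedes 0 i.succ (Fin.succ_pos i) x hx y hy

theorem containsLarge_zero_iff : ContainsLarge [0] X ↔ X.Nonempty := by
  constructor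
  · rintro ⟨_ | ⟨x, l⟩, -, hlX, hrun⟩
    · simp at hrun
    · exact ⟨x, hlX x List.mem_cons_self⟩
  · rintro ⟨x, hx⟩
    exact ⟨[x], List.pairwise_singleton _ _, by simpa using hx, rfl⟩

theorem containsLarge_succ_iff_exists_replicate :
    ContainsLarge [n + 1] X ↔ ∃ x ∈ X, ContainsLarge (List.replicate x n) {y ∈ X | x < y} := by
  have fundExps_singleton (x : ℕ) : CNF.fundExps x [n + 1] = List.replicate x n :=
    List.append_nil _
  constructor
  · rintro ⟨_ | ⟨x, l⟩, hl, hlX, hrun⟩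
    · simp at hrun
    · rw [runExps_cons_right, fundExps_singleton] at hrun
      obtain ⟨hx, hl⟩ := List.pairwise_cons.1 hl
      refine ⟨x, hlX x List.mem_cons_self, l, hl, fun y hy => ?_, hrun⟩
      exact Finset.mem_filter.2 ⟨hlX y (List.mem_cons_of_mem x hy), hx y hy⟩
  · rintro ⟨x, hx, l, hl, hlX, hrun⟩
    refine ⟨x :: l, List.pairwise_cons.2 ⟨fun y hy => (Finset.mem_filter.1 (hlX y hy)).2, hl⟩,
      ?_, by rwa [runExps_cons_right, fundExps_singleton]⟩
    exact List.forall_mem_cons.2 ⟨hx, fun y hy => (Finset.mem_filter.1 (hlX y hy)).1⟩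

theorem containsLarge_succ_iff :
    ContainsLarge [n + 1] X ↔ ∃ x ∈ X, ∃ f : Fin x → Finset ℕ,
      IsBlockSequence f {y ∈ X | x < y} ∧ ∀ i, ContainsLarge [n] (f i) := by
  simp only [containsLarge_succ_iff_exists_replicate, containsLarge_replicate_iff]

theorem containsLarge_singleton_zero (n : ℕ) : ContainsLarge [n] {0} := by
  cases n with
  | zero => exact containsLarge_zero_iff.2 (Finset.singleton_nonempty 0)
  | succ n =>
    exact containsLarge_succ_iff_exists_replicate.2
      ⟨0, Finset.mem_singleton_self 0, containsLarge_nil _⟩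

theorem ContainsLarge.of_succ (h : ContainsLarge [n + 1] X) : ContainsLarge [n] X := by
  obtain ⟨x, hx, f, hf, hlarge⟩ := containsLarge_succ_iff.1 h
  rcases Nat.eq_zero_or_pos x with rfl | hpos
  · exact (containsLarge_singleton_zero n).mono (Finset.singleton_subset_iff.2 hx)
  · exact (hlarge ⟨0, hpos⟩).mono ((hf.subset _).trans (Finset.filter_subset _ _))

theorem ContainsLarge.of_le (h : ContainsLarge [n] X) (hmn : m ≤ n) : ContainsLarge [m] X := by
  induction hmn using Nat.decreasingInduction with
  | self => exact h
  | of_succ _ _ ih => exact ih.of_succ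

theorem ContainsLarge.nonempty (h : ContainsLarge [n] X) : X.Nonempty :=
  containsLarge_zero_iff.1 (h.of_le (Nat.zero_le n))

theorem ContainsLarge.exists_precedes (h : ContainsLarge [n + 1] X) (hX : ∀ x ∈ X, 2 ≤ x) :
    ∃ Y ⊆ X, ∃ Z ⊆ X, Precedes Y Z ∧ ContainsLarge [n] Y ∧ ContainsLarge [n] Z := by
  obtain ⟨x, hx, f, hf, hlarge⟩ := containsLarge_succ_iff.1 h
  have hfX := hf.mono (Finset.filter_subset _ _)
  exact ⟨f ⟨0, by grind⟩, hfX.subset _, f ⟨1, hX x hx⟩, hfX.subset _,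
    hf.precedes _ _ (by simp), hlarge _, hlarge _⟩

end

/-! ### The pigeonhole principle -/

/-- The exponents of an ordinal are the heads of a hydra, and `regrow x j` collects the heads that
replace a head `j` cut off at stage `x`. -/
def regrow (x : ℕ) : ℕ → Multiset ℕ
  | 0 => 0
  | j + 1 => Multiset.replicate x j

/-- Whichever heads are cut, the hydra `S` dies along `l`. -/
def Dies : Multiset ℕ → List ℕ → Prop
  | S, [] => S = 0
  | S, x :: l => ∀ j ∈ S, Dies (S.erase j + regrow x j) l

/-- The heads `F` may replace the head `t`: either a single head that is not larger, or at most `z`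
smaller heads. -/
def ReplacesHead (z : ℕ) (F : Multiset ℕ) (t : ℕ) : Prop :=
  (∃ s ≤ t, F = {s}) ∨ F.card ≤ z ∧ ∀ s ∈ F, s < t

/-- The hydra `S` arises from `T` by one replacement, in the sense of `ReplacesHead`, of each head.
Such a reduct dies no later than `T`, see `Dies.of_reduct`. -/
def Reduct (z : ℕ) (S T : Multiset ℕ) : Prop :=
  ∃ U : Multiset (Multiset ℕ), U.join = S ∧ U.Rel (ReplacesHead z) T

section

variable {m j s t u x z : ℕ} {S S' T T' F : Multiset ℕ}

theorem card_regrow_le (x s : ℕ) : (regrow x s).card ≤ x := by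
  cases s <;> simp [regrow]

theorem lt_of_mem_regrow (h : j ∈ regrow x s) : j < s := by
  cases s with
  | zero => simp [regrow] at h
  | succ s => exact Nat.lt_succ_of_le (Multiset.eq_of_mem_replicate h).le

theorem ReplacesHead.mono (h : ReplacesHead z F t) (hzx : z ≤ x) : ReplacesHead x F t :=
  h.imp_right fun ⟨hcard, hlt⟩ => ⟨hcard.trans hzx, hlt⟩

theorem ReplacesHead.reduct (h : ReplacesHead z F t) : Reduct z F {t} :=
  ⟨{F}, by simp, Multiset.Rel.cons h Multiset.Rel.zero⟩

theorem Reduct.mono (h : Reduct z S T) (hzx : z ≤ x) : Reduct x S T := by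
  obtain ⟨U, hU, hrel⟩ := h
  exact ⟨U, hU, hrel.mono fun _ _ _ _ hF => hF.mono hzx⟩

theorem Reduct.add (h : Reduct z S T) (h' : Reduct z S' T') : Reduct z (S + S') (T + T') := by
  obtain ⟨U, rfl, hrel⟩ := h
  obtain ⟨U', rfl, hrel'⟩ := h'
  exact ⟨U + U', Multiset.join_add U U', hrel.add hrel'⟩

theorem Reduct.zero : Reduct z 0 0 := ⟨0, Multiset.join_zero, Multiset.Rel.zero⟩

theorem Reduct.refl (z : ℕ) (S : Multiset ℕ) : Reduct z S S := by
  induction S using Multiset.induction_on with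
  | empty => exact Reduct.zero
  | cons a S ih => exact (ReplacesHead.reduct (Or.inl ⟨a, le_rfl, rfl⟩)).add ih

theorem Reduct.zero_left (z : ℕ) (T : Multiset ℕ) : Reduct z 0 T := by
  induction T using Multiset.induction_on with
  | empty => exact Reduct.zero
  | cons a T ih =>
    have h : ReplacesHead z 0 a := Or.inr ⟨Nat.zero_le z, by simp⟩
    exact h.reduct.add ih

theorem reduct_replicate (hcard : F.card ≤ m) (hF : ∀ s ∈ F, s ≤ u) :
    Reduct z F (Multiset.replicate m u) := by
  induction F using Multiset.induction_on generalizing m with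
  | empty => exact Reduct.zero_left _ _
  | cons a F ih =>
    obtain ⟨hau, hF⟩ := Multiset.forall_mem_cons.1 hF
    obtain _ | m := m
    · simp at hcard
    · rw [Multiset.card_cons, Nat.succ_le_succ_iff] at hcard
      exact (ReplacesHead.reduct (Or.inl ⟨a, hau, rfl⟩)).add (ih hcard hF)

theorem ReplacesHead.reduct_cut (h : ReplacesHead z F t) (hzx : z ≤ x) (hs : s ∈ F) :
    Reduct x (F.erase s + regrow x s) (regrow x t) := by
  rcases h with ⟨s', hst, rfl⟩ | ⟨hcard, hlt⟩
  · obtain rfl := Multiset.mem_singleton.1 hs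
    rw [Multiset.erase_singleton, zero_add]
    obtain _ | t := t
    · simpa [Nat.le_zero.1 hst] using Reduct.refl x (regrow x 0)
    · exact reduct_replicate (card_regrow_le x s)
        fun a ha => Nat.le_of_lt_succ ((lt_of_mem_regrow ha).trans_le hst)
  · obtain ⟨u, rfl⟩ : ∃ u, t = u + 1 := Nat.exists_eq_succ_of_ne_zero (by grind)
    obtain ⟨y, rfl⟩ : ∃ y, x = y + 1 :=
      Nat.exists_eq_succ_of_ne_zero (by grind [Multiset.card_pos_iff_exists_mem])
    have hrest : Reduct (y + 1) (F.erase s) (Multiset.replicate y u) :=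
      reduct_replicate (by grind [Multiset.card_erase_add_one])
        fun a ha => Nat.le_of_lt_succ (hlt a (Multiset.mem_of_mem_erase ha))
    have hregrow : ReplacesHead (y + 1) (regrow (y + 1) s) u :=
      Or.inr ⟨card_regrow_le _ _,
        fun a ha => (lt_of_mem_regrow ha).trans_le (Nat.le_of_lt_succ (hlt s hs))⟩
    rw [add_comm (F.erase s)]
    exact hregrow.reduct.add hrest

theorem Reduct.exists_cut (h : Reduct z S T) (hzx : z ≤ x) (hs : s ∈ S) :
    ∃ t ∈ T, Reduct x (S.erase s + regrow x s) (T.erase t + regrow x t) := by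
  obtain ⟨U, rfl, hrel⟩ := h
  obtain ⟨F, hF, hsF⟩ := Multiset.mem_join.1 hs
  obtain ⟨U, rfl⟩ := Multiset.exists_cons_of_mem hF
  obtain ⟨t, T, hFt, hrel', rfl⟩ := Multiset.rel_cons_left.1 hrel
  have hrest : Reduct x U.join T := Reduct.mono ⟨U, rfl, hrel'⟩ hzx
  refine ⟨t, Multiset.mem_cons_self t T, ?_⟩
  rw [Multiset.join_cons, Multiset.erase_add_left_pos _ hsF, Multiset.erase_cons_head,
    add_right_comm, add_comm T]
  exact (hFt.reduct_cut hzx hsF).add hrest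

theorem Dies.of_reduct {l : List ℕ} (hT : Dies T l) (h : Reduct z S T) (hl : l.Pairwise (· < ·))
    (hz : ∀ x ∈ l, z ≤ x) : Dies S l := by
  induction l generalizing z S T with
  | nil =>
    obtain ⟨U, rfl, hrel⟩ := h
    obtain rfl : U = 0 := Multiset.rel_zero_right.1 (hT ▸ hrel)
    rfl
  | cons x l ih =>
    intro s hs
    obtain ⟨hx, hl⟩ := List.pairwise_cons.1 hl
    obtain ⟨t, ht, hcut⟩ := h.exists_cut (hz x List.mem_cons_self) hs
    exact ih (hT t ht) hcut hl fun y hy => (hx y hy).le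

-- Keep the other heads, and let `m` together with the regrowth of `j` replace the head `j`.
theorem reduct_cut_of_le (hm : m ∈ S) (hj : j ∈ S) (hmj : m ≤ j) :
    Reduct (x + 1) (S.erase j + regrow x j) (S.erase m + regrow x m) := by
  rcases hmj.eq_or_lt with rfl | hmj
  · exact Reduct.refl _ _
  obtain ⟨R, rfl⟩ := Multiset.exists_cons_of_mem hm
  have hjR : j ∈ R := (Multiset.mem_cons.1 hj).resolve_left hmj.ne'
  obtain ⟨R, rfl⟩ := Multiset.exists_cons_of_mem hjR
  have hreplace : ReplacesHead (x + 1) (m ::ₘ regrow x j) j :=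
    Or.inr ⟨by simpa using card_regrow_le x j,
      Multiset.forall_mem_cons.2 ⟨hmj, fun _ => lt_of_mem_regrow⟩⟩
  rw [Multiset.erase_cons_head, Multiset.cons_swap, Multiset.erase_cons_head,
    Multiset.cons_add, add_comm R, ← Multiset.cons_add, ← add_zero ((m ::ₘ _) + _)]
  exact (hreplace.reduct.add (Reduct.refl _ R)).add (Reduct.zero_left _ _)

theorem coe_fundExps_cons (x a : ℕ) (A : List ℕ) :
    (CNF.fundExps x (a :: A) : Multiset ℕ) = A + regrow x a := by
  cases a with
  | zero => exact (add_zero _).symm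
  | succ a => rw [CNF.fundExps, ← Multiset.coe_add, add_comm]; rfl

-- A fundamental sequence always cuts a smallest head, and this keeps the hydra alive the longest.
theorem dies_of_runExps {A l : List ℕ} (hA : A.Pairwise (· ≤ ·)) (hl : l.Pairwise (· < ·))
    (h : runExps A l = []) : Dies A l := by
  induction l generalizing A with
  | nil => exact congrArg _ h
  | cons x l ih =>
    obtain ⟨hx, hl⟩ := List.pairwise_cons.1 hl
    have hcut := ih (CNF.fundExps_sorted x hA) hl h
    intro j hj
    obtain _ | ⟨m, A⟩ := A
    · simp at hj
    · rw [coe_fundExps_cons] at hcut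
      have hmj : m ≤ j := by
        rcases List.mem_cons.1 hj with rfl | hj
        exacts [le_rfl, List.rel_of_pairwise_cons hA hj]
      refine Dies.of_reduct (z := x + 1) ?_ (reduct_cut_of_le (m := m) (by simp) hj hmj) hl hx
      simpa using hcut

end

section

variable {κ : Type*} [Fintype κ] {n : ℕ} {X : Finset ℕ}

-- Run one ordinal per colour, and let `x` act on the ordinal of its colour: on the sum of the
-- ordinals this cuts some head, so that the hydra of the sum bounds the whole process.
theorem exists_runExps_filter_eq_nil [DecidableEq κ] [Nonempty κ] (f : ℕ → κ) {l : List ℕ}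
    (α : κ → List ℕ) (h : Dies (∑ i, (α i : Multiset ℕ)) l) :
    ∃ i, runExps (α i) (l.filter (f · = i)) = [] := by
  induction l generalizing α with
  | nil =>
    have hzero : ∑ i, (α i : Multiset ℕ) = 0 := h
    exact ⟨Classical.arbitrary κ,
      (Multiset.coe_eq_zero _).1 (Finset.sum_eq_zero_iff.1 hzero _ (Finset.mem_univ _))⟩
  | cons x l ih =>
    rcases hα : α (f x) with _ | ⟨a, A⟩
    · exact ⟨f x, by rw [hα, runExps_nil_left]⟩
    have hsum : (∑ i, (α i : Multiset ℕ)).erase a + regrow x a =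
        ∑ i, (Function.update α (f x) (CNF.fundExps x (a :: A)) i : Multiset ℕ) := by
      rw [← Finset.add_sum_erase _ _ (Finset.mem_univ (f x)),
        ← Finset.add_sum_erase _ _ (Finset.mem_univ (f x)), Function.update_self,
        coe_fundExps_cons, hα, ← Multiset.cons_coe, Multiset.cons_add, Multiset.erase_cons_head,
        add_right_comm]
      congr 1
      refine Finset.sum_congr rfl fun i hi => ?_
      rw [Function.update_of_ne (Finset.ne_of_mem_erase hi)]
    have ha : a ∈ ∑ i, (α i : Multiset ℕ) :=
      Multiset.mem_sum.2 ⟨f x, Finset.mem_univ _, by simp [hα]⟩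
    obtain ⟨i, hi⟩ := ih (Function.update α (f x) (CNF.fundExps x (a :: A))) (hsum ▸ h a ha)
    refine ⟨i, ?_⟩
    by_cases hix : f x = i
    · subst hix
      rwa [List.filter_cons_of_pos (by simp), hα, runExps_cons_right,
        ← Function.update_self (f x) (CNF.fundExps x (a :: A)) α]
    · rwa [List.filter_cons_of_neg (by simpa using hix),
        ← Function.update_of_ne (Ne.symm hix) (CNF.fundExps x (a :: A)) α]

theorem ContainsLarge.exists_fiber [DecidableEq κ] (h : ContainsLarge [n + 1] X) (f : ℕ → κ)
    (hκ : ∀ x ∈ X, Fintype.card κ ≤ x) : ∃ i, ContainsLarge [n] {x ∈ X | f x = i} := by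
  obtain ⟨x, hx, l, hl, hlX, hrun⟩ := containsLarge_succ_iff_exists_replicate.1 h
  have hdies : Dies (∑ _ : κ, (([n] : List ℕ) : Multiset ℕ)) l := by
    refine (dies_of_runExps (List.pairwise_replicate.2 (Or.inr le_rfl)) hl hrun).of_reduct
      (z := 0) ?_ hl fun _ _ => Nat.zero_le _
    rw [Finset.sum_const, Finset.card_univ, Multiset.coe_singleton, Multiset.nsmul_singleton,
      Multiset.coe_replicate]
    exact reduct_replicate (by simpa using hκ x hx)
      fun s hs => (Multiset.eq_of_mem_replicate hs).le
  have : Nonempty κ := ⟨f x⟩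
  obtain ⟨i, hi⟩ := exists_runExps_filter_eq_nil f (fun _ => [n]) hdies
  refine ⟨i, l.filter (f · = i), hl.filter _, fun y hy => ?_, hi⟩
  obtain ⟨hy, hyi⟩ := List.mem_filter.1 hy
  exact Finset.mem_filter.2 ⟨(Finset.mem_filter.1 (hlX y hy)).1, of_decide_eq_true hyi⟩

theorem ContainsLarge.exists_forall_eq {ι : Type*} [Fintype ι] (h : ContainsLarge [n + 1] X)
    (q : ι → ℕ → κ) (hκ : ∀ x ∈ X, Fintype.card κ ^ Fintype.card ι ≤ x) :
    ∃ d : ι → κ, ∃ Y ⊆ X, ContainsLarge [n] Y ∧ ∀ i, ∀ x ∈ Y, q i x = d i := by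
  classical
  obtain ⟨d, hd⟩ := h.exists_fiber (fun x i => q i x) (by simpa using hκ)
  exact ⟨d, _, Finset.filter_subset _ X, hd,
    fun i x hx => congrFun (Finset.mem_filter.1 hx).2 i⟩

end

/-! ### Sparse sets -/

/-- The relation `r` holds between any two elements of `X`, taken in increasing order. -/
def IncreasingPairs {ι : Type*} [LT ι] (r : ι → ι → Prop) (X : Finset ι) : Prop :=
  ∀ x ∈ X, ∀ y ∈ X, x < y → r x y

theorem IncreasingPairs.mono {ι : Type*} [LT ι] {r : ι → ι → Prop} {X Y : Finset ι}
    (h : IncreasingPairs r Y) (hXY : X ⊆ Y) : IncreasingPairs r X :=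
  fun x hx y hy => h x (hXY hx) y (hXY hy)

theorem increasingPairs_singleton {ι : Type*} [Preorder ι] (r : ι → ι → Prop) (x : ι) :
    IncreasingPairs r {x} := by
  intro y hy z hz hyz
  rw [Finset.mem_singleton.1 hy, Finset.mem_singleton.1 hz] at hyz
  exact absurd hyz (lt_irrefl x)

/-- A set of positive numbers in which every element is at least exponential in its predecessors. -/
structure Sparse (X : Finset ℕ) : Prop where
  zero_notMem : 0 ∉ X
  four_pow_le : IncreasingPairs (fun x y => 4 ^ x ≤ y) X

section

variable {n u w x : ℕ} {S X Y : Finset ℕ} {r : ℕ → ℕ → Prop}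

theorem IsBlockSequence.exists_containsLarge_succ (hx : x ∈ X) {f : Fin x → Finset ℕ}
    (hf : IsBlockSequence f {y ∈ X | x < y}) (hlarge : ∀ i, ContainsLarge [n] (f i))
    (hxf : ∀ i, ∀ y ∈ f i, r x y) (hff : ∀ i j, i < j → ∀ y ∈ f i, ∀ z ∈ f j, r y z)
    (hfi : ∀ i, IncreasingPairs r (f i)) :
    ∃ Y ⊆ X, ContainsLarge [n + 1] Y ∧ IncreasingPairs r Y := by
  have hlt (i) (y) (hy : y ∈ f i) : x < y := (Finset.mem_filter.1 (hf.subset i hy)).2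
  have hfY (i) : f i ⊆ insert x (Finset.univ.biUnion f) :=
    (Finset.subset_biUnion_of_mem f (Finset.mem_univ i)).trans (Finset.subset_insert x _)
  refine ⟨insert x (Finset.univ.biUnion f), Finset.insert_subset hx (Finset.biUnion_subset.2
    fun i _ => (hf.subset i).trans (Finset.filter_subset _ _)), ?_, fun y hy z hz hyz => ?_⟩
  · exact containsLarge_succ_iff.2 ⟨x, Finset.mem_insert_self x _, f,
      ⟨fun i y hy => Finset.mem_filter.2 ⟨hfY i hy, hlt i y hy⟩, hf.precedes⟩, hlarge⟩
  · simp only [Finset.mem_insert, Finset.mem_biUnion, Finset.mem_univ, true_and] at hy hz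
    rcases hy with rfl | ⟨i, hy⟩ <;> rcases hz with rfl | ⟨j, hz⟩
    · exact absurd hyz (lt_irrefl _)
    · exact hxf j z hz
    · exact absurd hyz (hlt i y hy).not_gt
    · rcases lt_trichotomy i j with hij | rfl | hij
      · exact hff i j hij y hy z hz
      · exact hfi i y hy z hz hyz
      · exact absurd hyz (hf.precedes j i hij z hz y hy).not_gt

theorem ContainsLarge.exists_iterate_lt {g : ℕ → ℕ}
    (hg : ∀ {u w S}, ContainsLarge [n] S → (∀ x ∈ S, u < x ∧ x < w) → g u < w)
    (hS : ContainsLarge [n + 1] S) (hw : ∀ x ∈ S, x < w) : ∃ x ∈ S, g^[x] x < w := by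
  obtain ⟨x, hx, f, hf, hlarge⟩ := containsLarge_succ_iff.1 hS
  have key (k : ℕ) (hk : k ≤ x) (v : ℕ) (hxv : x < v)
      (hfv : ∀ i : Fin x, i < k → ∀ y ∈ f i, y < v) : g^[k] x < v := by
    induction k generalizing v with
    | zero => exact hxv
    | succ k ih =>
      rw [Function.iterate_succ_apply']
      refine hg (hlarge ⟨k, hk⟩) fun y hy => ⟨ih (Nat.le_of_succ_le hk) y ?_ ?_, ?_⟩
      · exact (Finset.mem_filter.1 (hf.subset _ hy)).2
      · exact fun i hi z hz => hf.precedes i ⟨k, hk⟩ hi z hz y hy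
      · exact hfv ⟨k, hk⟩ k.lt_succ_self y hy
  exact ⟨x, hx, key x le_rfl w (hw x hx)
    fun i _ y hy => hw y (Finset.mem_filter.1 (hf.subset i hy)).1⟩

theorem ContainsLarge.succ_lt (hS : ContainsLarge [0] S) (hu : ∀ x ∈ S, u < x ∧ x < w) :
    Nat.succ u < w := by
  obtain ⟨x, hx⟩ := hS.nonempty
  exact (Nat.succ_le_of_lt (hu x hx).1).trans_lt (hu x hx).2

theorem ContainsLarge.two_mul_lt (hS : ContainsLarge [1] S) (hu : ∀ x ∈ S, u < x ∧ x < w) :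
    2 * u < w := by
  obtain ⟨x, hx, hlt⟩ := hS.exists_iterate_lt succ_lt fun x hx => (hu x hx).2
  rw [Nat.succ_iterate] at hlt
  have := (hu x hx).1
  omega

theorem ContainsLarge.two_pow_lt (hS : ContainsLarge [2] S) (hu : ∀ x ∈ S, u < x ∧ x < w) :
    2 ^ u < w := by
  obtain ⟨x, hx, hlt⟩ := hS.exists_iterate_lt two_mul_lt fun x hx => (hu x hx).2
  have hux := (hu x hx).1
  rw [mul_left_iterate] at hlt
  calc 2 ^ u ≤ 2 ^ x := Nat.pow_le_pow_right two_pos hux.le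
    _ ≤ 2 ^ x * x := Nat.le_mul_of_pos_right _ (Nat.zero_lt_of_lt hux)
    _ < w := hlt

theorem ContainsLarge.four_pow_lt (hS : ContainsLarge [3] S) (hu : ∀ x ∈ S, u < x ∧ x < w)
    (hpos : 0 < u) : 4 ^ u < w := by
  obtain ⟨x, hx, hlt⟩ := hS.exists_iterate_lt two_pow_lt fun x hx => (hu x hx).2
  have hux : u + 1 ≤ x := (hu x hx).1
  have h2u : 2 * u ≤ 2 ^ x := calc
    2 * u ≤ 2 * 2 ^ u := Nat.mul_le_mul_left 2 Nat.lt_two_pow_self.le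
    _ = 2 ^ (u + 1) := (pow_succ' 2 u).symm
    _ ≤ 2 ^ x := Nat.pow_le_pow_right two_pos hux
  have hid : id ≤ fun v => 2 ^ v := fun v => Nat.lt_two_pow_self.le
  calc 4 ^ u = 2 ^ (2 * u) := by rw [pow_mul]; norm_num
    _ ≤ 2 ^ 2 ^ x := Nat.pow_le_pow_right two_pos h2u
    _ ≤ (fun v => 2 ^ v)^[x] x :=
      Function.monotone_iterate_of_id_le hid (by omega : 2 ≤ x) x
    _ < w := hlt

theorem Sparse.mono (h : Sparse Y) (hXY : X ⊆ Y) : Sparse X :=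
  ⟨fun h0 => h.zero_notMem (hXY h0), h.four_pow_le.mono hXY⟩

theorem Sparse.two_pow_card_le (h : Sparse X) {F : Finset ℕ} (hFX : F ⊆ X) (hx : x ∈ X)
    (hF : ∀ y ∈ F, y < x) : 2 ^ F.card ≤ x := by
  have hpos {y : ℕ} (hy : y ∈ X) : 0 < y :=
    Nat.pos_of_ne_zero fun hy0 => h.zero_notMem (hy0 ▸ hy)
  rcases F.eq_empty_or_nonempty with rfl | hne
  · exact hpos hx
  · have hmax := F.max'_mem hne
    have hcard : F.card ≤ F.max' hne := by
      have hsub : F ⊆ Finset.Icc 1 (F.max' hne) := fun y hy =>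
        Finset.mem_Icc.2 ⟨hpos (hFX hy), F.le_max' y hy⟩
      simpa using Finset.card_le_card hsub
    calc 2 ^ F.card ≤ 2 ^ F.max' hne := Nat.pow_le_pow_right two_pos hcard
      _ ≤ 4 ^ F.max' hne := Nat.pow_le_pow_left (by norm_num) _
      _ ≤ x := h.four_pow_le _ (hFX hmax) x hx (hF _ hmax)

-- Each block is split into a buffer, across which numbers grow exponentially, and a second half
-- to which the induction hypothesis applies.
theorem ContainsLarge.exists_sparse (h : ContainsLarge [2 * n + 3] X) (h0 : 0 ∉ X) :
    ∃ Y ⊆ X, Sparse Y ∧ ContainsLarge [n] Y := by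
  induction n generalizing X with
  | zero =>
    obtain ⟨x, hx⟩ := h.nonempty
    exact ⟨{x}, Finset.singleton_subset_iff.2 hx,
      ⟨fun hx0 => h0 (Finset.mem_singleton.1 hx0 ▸ hx), increasingPairs_singleton _ x⟩,
      containsLarge_zero_iff.2 (Finset.singleton_nonempty x)⟩
  | succ n ih =>
    obtain ⟨x, hx, f, hf, hlarge⟩ := containsLarge_succ_iff.1 h
    have hlt (i) (y) (hy : y ∈ f i) : x < y := (Finset.mem_filter.1 (hf.subset i hy)).2
    have hpos : 0 < x := Nat.pos_of_ne_zero fun hx0 => h0 (hx0 ▸ hx)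
    have hsplit (i) := (hlarge i).exists_precedes fun y hy =>
      (Nat.succ_le_of_lt hpos).trans_lt (hlt i y hy)
    choose buffer hbuffer rest hrest hprec hbufferLarge hrestLarge using hsplit
    have hrest0 (i) : 0 ∉ rest i := fun h => Nat.not_lt_zero x (hlt i 0 (hrest i h))
    choose g hg hsparse hgLarge using fun i => ih (hrestLarge i) (hrest0 i)
    have hbetween (i) (y z : ℕ) (hy : ∀ v ∈ f i, y < v) (hypos : 0 < y) (hz : z ∈ g i) :
        4 ^ y ≤ z :=
      (ContainsLarge.four_pow_lt ((hbufferLarge i).of_le (by omega)) (fun v hv =>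
        ⟨hy v (hbuffer i hv), hprec i v hv z (hg i hz)⟩) hypos).le
    have hgf (i) : g i ⊆ f i := (hg i).trans (hrest i)
    obtain ⟨Y, hYX, hY, hpairs⟩ := (hf.refine hgf).exists_containsLarge_succ hx hgLarge
      (fun i y hy => hbetween i x y (hlt i) hpos hy)
      (fun i j hij y hy z hz => hbetween j y z (hf.precedes i j hij y (hgf i hy))
        (hpos.trans (hlt i y (hgf i hy))) hz)
      (fun i => (hsparse i).four_pow_le)
    exact ⟨Y, hYX, ⟨fun hY0 => h0 (hYX hY0), hpairs⟩, hY⟩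

end

/-! ### Homogeneous sets for colourings of pairs -/

theorem sum_update_pred_add_one {κ : Type*} [Fintype κ] [DecidableEq κ] {p : κ → ℕ} {b : κ}
    (hb : 0 < p b) : ∑ i, Function.update p b (p b - 1) i + 1 = ∑ i, p i := by
  rw [Finset.sum_update_of_mem (Finset.mem_univ b), Finset.sum_eq_add_sum_sdiff_singleton_of_mem
    (Finset.mem_univ b) p]
  omega

theorem IncreasingPairs.insert {ι : Type*} [LinearOrder ι] {r : ι → ι → Prop} {X : Finset ι}
    {m : ι} (h : IncreasingPairs r X) (hm : ∀ x ∈ X, m < x ∧ r m x) :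
    IncreasingPairs r (insert m X) := by
  intro x hx y hy hxy
  rcases Finset.mem_insert.1 hx with rfl | hx <;> rcases Finset.mem_insert.1 hy with hym | hy
  · exact absurd hxy hym.not_gt
  · exact (hm y hy).2
  · exact absurd hxy (hym ▸ (hm x hx).1.not_gt)
  · exact h x hx y hy hxy

section

variable {ι κ : Type*} [Fintype κ] [Nontrivial κ]

theorem exists_pow_le_card_fiber_erase [DecidableEq ι] [DecidableEq κ] {S : Finset ι} {s : ℕ}
    {m : ι} (hm : m ∈ S) (hS : Fintype.card κ ^ (s + 1) ≤ S.card) (f : ι → κ) :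
    ∃ b, Fintype.card κ ^ s ≤ {x ∈ S.erase m | f x = b}.card := by
  have hk : 1 < Fintype.card κ := Fintype.one_lt_card
  have hcard : Fintype.card κ * (Fintype.card κ ^ s - 1) < (S.erase m).card := by
    rw [Finset.card_erase_of_mem hm, Nat.mul_sub, mul_one, ← pow_succ']
    have : Fintype.card κ ≤ Fintype.card κ ^ (s + 1) := Nat.le_self_pow s.succ_ne_zero _
    omega
  obtain ⟨b, -, hb⟩ := Finset.exists_lt_card_fiber_of_mul_lt_card_of_maps_to
    (fun x _ => Finset.mem_univ (f x)) hcard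
  exact ⟨b, Nat.le_of_pred_lt hb⟩

theorem exists_subset_card_increasingPairs [LinearOrder ι] (c : ι → ι → κ) (p : κ → ℕ)
    {S : Finset ι} (hS : Fintype.card κ ^ ∑ b, p b ≤ S.card) :
    ∃ b, ∃ H ⊆ S, p b ≤ H.card ∧ IncreasingPairs (c · · = b) H := by
  classical
  have of_eq_zero {p : κ → ℕ} {b : κ} (hb : p b = 0) (S : Finset ι) :
      ∃ b, ∃ H ⊆ S, p b ≤ H.card ∧ IncreasingPairs (c · · = b) H :=
    ⟨b, ∅, Finset.empty_subset S, hb.trans_le (Nat.zero_le _), by simp [IncreasingPairs]⟩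
  induction hs : ∑ b, p b generalizing p S with
  | zero =>
    exact of_eq_zero (Finset.sum_eq_zero_iff.1 hs (Classical.arbitrary κ) (Finset.mem_univ _)) S
  | succ s ih =>
    by_cases h0 : ∃ b, p b = 0
    · exact of_eq_zero h0.choose_spec S
    push Not at h0
    rw [hs] at hS
    have hne : S.Nonempty := Finset.card_pos.1 ((Nat.pow_pos Fintype.card_pos).trans_le hS)
    set m := S.min' hne
    obtain ⟨b, hb⟩ := exists_pow_le_card_fiber_erase (S.min'_mem hne) hS (c m)
    have hsum : ∑ i, Function.update p b (p b - 1) i = s :=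
      Nat.succ_injective ((sum_update_pred_add_one (Nat.pos_of_ne_zero (h0 b))).trans hs)
    obtain ⟨b', H, hH, hcard, hhom⟩ := ih _ (hsum.symm ▸ hb) hsum
    have hHS : H ⊆ S := hH.trans ((Finset.filter_subset _ _).trans (Finset.erase_subset _ _))
    have hmH (x) (hx : x ∈ H) : m < x ∧ c m x = b :=
      ⟨S.min'_lt_of_mem_erase_min' hne (Finset.mem_filter.1 (hH hx)).1,
        (Finset.mem_filter.1 (hH hx)).2⟩
    by_cases hbb : b' = b
    · subst hbb
      refine ⟨b', insert m H, Finset.insert_subset (S.min'_mem hne) hHS, ?_, hhom.insert hmH⟩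
      rw [Finset.card_insert_of_notMem fun h => lt_irrefl m (hmH m h).1]
      exact Nat.le_succ_of_pred_le (by rwa [Function.update_self] at hcard)
    · exact ⟨b', H, hHS, by rwa [Function.update_of_ne hbb] at hcard, hhom⟩

end

/-- `X` contains `k` successive `ω ^ n`-large blocks such that any two elements from different
blocks form a pair of colour `b`. -/
def HasMonochromaticBlocks {κ : Type*} (c : ℕ → ℕ → κ) (b : κ) (n k : ℕ) (X : Finset ℕ) : Prop :=
  ∃ f : Fin k → Finset ℕ, IsBlockSequence f X ∧ (∀ i, ContainsLarge [n] (f i)) ∧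
    ∀ i j, i < j → ∀ x ∈ f i, ∀ y ∈ f j, c x y = b

theorem HasMonochromaticBlocks.mono {κ : Type*} {c : ℕ → ℕ → κ} {b : κ} {m n k l : ℕ}
    {X Y : Finset ℕ} (h : HasMonochromaticBlocks c b n l X) (hmn : m ≤ n) (hkl : k ≤ l)
    (hXY : X ⊆ Y) : HasMonochromaticBlocks c b m k Y := by
  obtain ⟨f, hf, hlarge, hc⟩ := h
  exact ⟨f ∘ Fin.castLE hkl, (hf.mono hXY).comp_strictMono (Fin.strictMono_castLE hkl),
    fun i => (hlarge _).of_le hmn, fun i j hij => hc _ _ (Fin.strictMono_castLE hkl hij)⟩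

section

variable {n u : ℕ} {X Z F : Finset ℕ} (c : ℕ → ℕ → Fin 2)

theorem ContainsLarge.exists_end_homogeneous (h : ContainsLarge [n + 1] X) (hZ : Sparse Z)
    (hX : X ⊆ Z) (hF : F ⊆ Z) (hFX : Precedes F X) :
    ∃ Y ⊆ X, ContainsLarge [n] Y ∧ ∃ d : ℕ → Fin 2, ∀ x ∈ F, ∀ y ∈ Y, c x y = d x := by
  obtain ⟨d, Y, hYX, hY, hd⟩ := h.exists_forall_eq (fun (x : F) y => c x y) fun y hy => by
    simpa using hZ.two_pow_card_le hF (hX hy) fun x hx => hFX x hx y hy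
  refine ⟨Y, hYX, hY, fun x => if hx : x ∈ F then d ⟨x, hx⟩ else 0, fun x hx y hy => ?_⟩
  simpa only [dif_pos hx] using hd ⟨x, hx⟩ y hy

theorem ContainsLarge.exists_grouping (h : ContainsLarge [n + 3] X) (hX : Sparse X) :
    ∃ r ∈ X, ∃ f : Fin r → Finset ℕ, ∃ d : Fin r → Fin r → Fin 2,
      IsBlockSequence f {y ∈ X | r < y} ∧ (∀ i, ContainsLarge [n] (f i)) ∧
        ∀ i j, i < j → ∀ x ∈ f i, ∀ y ∈ f j, c x y = d i j := by
  obtain ⟨r, hr, f, hf, hlarge⟩ := containsLarge_succ_iff.1 h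
  have hfX (i) : f i ⊆ X := (hf.subset i).trans (Finset.filter_subset _ _)
  -- First make the colour of `x < y` depend on `x` and the block of `y` only, ...
  have hend (j) := (hlarge j).exists_end_homogeneous c hX (hfX j)
    (Finset.filter_subset (fun x => ∀ y ∈ f j, x < y) X) fun x hx => (Finset.mem_filter.1 hx).2
  choose g hgf hgLarge d hd using hend
  -- ... then make this dependence the same for all `x` in a block.
  have hpow (i) (x) (hx : x ∈ g i) : 2 ^ r ≤ x := by
    obtain ⟨hxX, hrx⟩ := Finset.mem_filter.1 (hf.subset i (hgf i hx))
    exact (Nat.pow_le_pow_left (by norm_num) r).trans (hX.four_pow_le r hr x hxX hrx)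
  choose e B hBg hB he using fun i => (hgLarge i).exists_forall_eq d fun x hx => by
    simpa using hpow i x hx
  have hBf (i) : B i ⊆ f i := (hBg i).trans (hgf i)
  refine ⟨r, hr, B, e, hf.refine hBf, hB, fun i j hij x hx y hy => ?_⟩
  have hxF : x ∈ {x ∈ X | ∀ y ∈ f j, x < y} :=
    Finset.mem_filter.2 ⟨hfX i (hBf i hx), hf.precedes i j hij x (hBf i hx)⟩
  rw [hd j x hxF y (hBg j hy), he i j x hx]

theorem ContainsLarge.exists_hasMonochromaticBlocks (h : ContainsLarge [n + 3] X) (hX : Sparse X)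
    (hu : ∀ x ∈ X, 4 ^ u ≤ x) : ∃ b, HasMonochromaticBlocks c b n u X := by
  obtain ⟨r, hr, f, d, hf, hlarge, hd⟩ := h.exists_grouping c hX
  have hcard : Fintype.card (Fin 2) ^ ∑ _ : Fin 2, u ≤ (Finset.univ : Finset (Fin r)).card := by
    simpa [pow_mul] using hu r hr
  obtain ⟨b, H, -, hH, hhom⟩ := exists_subset_card_increasingPairs d (fun _ => u) hcard
  refine ⟨b, f ∘ H.orderEmbOfCardLe hH, (hf.mono (Finset.filter_subset _ _)).comp_strictMono
    (H.orderEmbOfCardLe hH).strictMono, fun i => hlarge _, fun i j hij x hx y hy => ?_⟩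
  have hlt := (H.orderEmbOfCardLe hH).strictMono hij
  rw [hd _ _ hlt x hx y hy]
  exact hhom _ (H.orderEmbOfCardLe_mem hH i) _ (H.orderEmbOfCardLe_mem hH j) hlt

theorem ContainsLarge.exists_color_neighbors (h : ContainsLarge [n + 2] X) (h0 : 0 ∉ X) :
    ∃ x ∈ X, ∃ b, ContainsLarge [n] {y ∈ X | x < y ∧ c x y = b} := by
  obtain ⟨x, hx, f, hf, hlarge⟩ := containsLarge_succ_iff.1 h
  have hpos : 0 < x := Nat.pos_of_ne_zero fun hx0 => h0 (hx0 ▸ hx)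
  have hlarge' : ContainsLarge [n + 1] {y ∈ X | x < y} :=
    (hlarge ⟨0, hpos⟩).mono (hf.subset _)
  obtain ⟨b, hb⟩ := hlarge'.exists_fiber (c x) fun y hy =>
    (Fintype.card_fin 2).trans_le ((Nat.succ_le_of_lt hpos).trans_lt (Finset.mem_filter.1 hy).2)
  exact ⟨x, hx, b, by rwa [Finset.filter_filter] at hb⟩

-- Look at blocks above `x` whose elements `y` all satisfy `c x y = b`. If they are not already
-- monochromatic of colour `b`, then some `u` in one of them has the other colour with all elements
-- of a later block. Blocks of either colour found there extend: by `x` or by `u`.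
theorem ContainsLarge.exists_hasMonochromaticBlocks_neighbors (h : ContainsLarge [n + 8] X)
    (hX : Sparse X) :
    ∃ b, ∃ x ∈ X, HasMonochromaticBlocks c b n x {y ∈ X | x < y ∧ c x y = b} := by
  obtain ⟨x, hx, b, hR⟩ := h.exists_color_neighbors c hX.zero_notMem
  set R := {y ∈ X | x < y ∧ c x y = b}
  have hRX : R ⊆ X := Finset.filter_subset _ X
  obtain ⟨r, hr, f, d, hf, hlarge, hd⟩ := hR.exists_grouping (n := n + 3) c (hX.mono hRX)
  have hxr : x < r := (Finset.mem_filter.1 hr).2.1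
  replace hf := hf.mono (Finset.filter_subset _ R)
  by_cases hall : ∀ i j, i < j → d i j = b
  · have hblocks : HasMonochromaticBlocks c b (n + 3) r R :=
      ⟨f, hf, hlarge, fun i j hij y hy z hz => (hd i j hij y hy z hz).trans (hall i j hij)⟩
    exact ⟨b, x, hx, hblocks.mono (Nat.le_add_right n 3) hxr.le subset_rfl⟩
  · push Not at hall
    obtain ⟨i, j, hij, hdb⟩ := hall
    obtain ⟨u, hu⟩ := (hlarge i).nonempty
    have huX : u ∈ X := hRX (hf.subset i hu)
    have hxu : x < u := (Finset.mem_filter.1 (hf.subset i hu)).2.1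
    have hjX : f j ⊆ X := (hf.subset j).trans hRX
    obtain ⟨b', hb'⟩ := (hlarge j).exists_hasMonochromaticBlocks (u := u) c (hX.mono hjX)
      fun y hy => hX.four_pow_le u huX y (hjX hy) (hf.precedes i j hij u hu y hy)
    by_cases hbb : b' = b
    · subst hbb
      exact ⟨b', x, hx, hb'.mono le_rfl hxu.le (hf.subset j)⟩
    · have hdb' : d i j = b' := by omega
      refine ⟨b', u, huX, hb'.mono le_rfl le_rfl fun y hy => Finset.mem_filter.2 ⟨hjX hy, ?_⟩⟩
      exact ⟨hf.precedes i j hij u hu y hy, (hd i j hij u hu y hy).trans hdb'⟩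

theorem ContainsLarge.exists_increasingPairs_of_sparse (p : Fin 2 → ℕ)
    (h : ContainsLarge [8 * ∑ b, p b] X) (hX : Sparse X) :
    ∃ b, ∃ Y ⊆ X, ContainsLarge [p b] Y ∧ IncreasingPairs (c · · = b) Y := by
  have of_eq_zero {p : Fin 2 → ℕ} {b : Fin 2} (hb : p b = 0) {X : Finset ℕ} (hX : X.Nonempty) :
      ∃ b, ∃ Y ⊆ X, ContainsLarge [p b] Y ∧ IncreasingPairs (c · · = b) Y := by
    obtain ⟨x, hx⟩ := hX
    refine ⟨b, {x}, Finset.singleton_subset_iff.2 hx, ?_, increasingPairs_singleton _ x⟩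
    rw [hb, containsLarge_zero_iff]
    exact Finset.singleton_nonempty x
  induction hs : ∑ b, p b generalizing p X with
  | zero => exact of_eq_zero (Finset.sum_eq_zero_iff.1 hs 0 (Finset.mem_univ 0)) h.nonempty
  | succ s ih =>
    by_cases h0 : ∃ b, p b = 0
    · exact of_eq_zero h0.choose_spec h.nonempty
    push Not at h0
    rw [hs] at h
    obtain ⟨b, x, hx, f, hf, hlarge, hff⟩ :=
      h.exists_hasMonochromaticBlocks_neighbors (n := 8 * s) c hX
    have hfX (i) : f i ⊆ X := (hf.subset i).trans (Finset.filter_subset _ _)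
    have hsum : ∑ i, Function.update p b (p b - 1) i = s :=
      Nat.succ_injective ((sum_update_pred_add_one (Nat.pos_of_ne_zero (h0 b))).trans hs)
    choose b' Y hYf hY hhom using
      fun i => ih _ (hsum.symm ▸ hlarge i) (hX.mono (hfX i)) hsum
    by_cases hother : ∃ i, b' i ≠ b
    · obtain ⟨i, hi⟩ := hother
      have hYi := hY i
      rw [Function.update_of_ne hi] at hYi
      exact ⟨b' i, Y i, (hYf i).trans (hfX i), hYi, hhom i⟩
    · push Not at hother
      simp only [hother, Function.update_self] at hY hhom
      obtain ⟨W, hWX, hW, hWhom⟩ := ((hf.refine hYf).mono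
        (Finset.monotone_filter_right X fun _ _ hy => hy.1)).exists_containsLarge_succ hx hY
        (fun i y hy => (Finset.mem_filter.1 (hf.subset i (hYf i hy))).2.2)
        (fun i j hij y hy z hz => hff i j hij y (hYf i hy) z (hYf j hz)) hhom
      rw [Nat.sub_add_cancel (Nat.one_le_iff_ne_zero.2 (h0 b))] at hW
      exact ⟨b, W, hWX, hW, hWhom⟩

theorem ContainsLarge.exists_increasingPairs {m : ℕ} (h : ContainsLarge [m] X) (hm : 35 * n ≤ m) :
    ∃ b, ∃ Y ⊆ X, ContainsLarge [n] Y ∧ IncreasingPairs (c · · = b) Y := by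
  by_cases h0 : 0 ∈ X
  · exact ⟨0, {0}, Finset.singleton_subset_iff.2 h0, containsLarge_singleton_zero n,
      increasingPairs_singleton _ 0⟩
  rcases Nat.eq_zero_or_pos n with rfl | hn
  · obtain ⟨x, hx⟩ := h.nonempty
    exact ⟨0, {x}, Finset.singleton_subset_iff.2 hx,
      containsLarge_zero_iff.2 (Finset.singleton_nonempty x), increasingPairs_singleton _ x⟩
  · have hlarge : ContainsLarge [2 * (8 * ∑ _ : Fin 2, n) + 3] X := h.of_le (by simp; omega)
    obtain ⟨Z, hZX, hZ, hZlarge⟩ := hlarge.exists_sparse h0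
    obtain ⟨b, Y, hYZ, hY⟩ := hZlarge.exists_increasingPairs_of_sparse c (fun _ => n) hZ
    exact ⟨b, Y, hYZ.trans hZX, hY⟩

end

/-- The colouring `P` of unordered pairs, as a function of the two elements. It takes the value `0`
where `P` is not defined. -/
def pairColor {X : Finset ℕ} {k : ℕ} [NeZero k] (P : X.powersetCard 2 → Fin k) (x y : ℕ) : Fin k :=
  if h : {x, y} ∈ X.powersetCard 2 then P ⟨{x, y}, h⟩ else 0

theorem IncreasingPairs.isHomogeneous {X Y : Finset ℕ} {k : ℕ} [NeZero k]
    {P : X.powersetCard 2 → Fin k} {b : Fin k} (h : IncreasingPairs (pairColor P · · = b) Y) :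
    IsHomogeneous P Y := by
  have hP (s : X.powersetCard 2) (hs : s.1 ⊆ Y) : P s = b := by
    obtain ⟨s, hsX⟩ := s
    obtain ⟨x, y, hxy, rfl⟩ := Finset.card_eq_two.1 (Finset.mem_powersetCard.1 hsX).2
    wlog hlt : x < y generalizing x y
    · simp only [Finset.pair_comm x y] at hsX hs ⊢
      exact this y x hxy.symm hsX hs (hxy.symm.lt_of_le (not_lt.1 hlt))
    have hcol : pairColor P x y = b := h x (hs (by simp)) y (hs (by simp)) hlt
    rwa [pairColor, dif_pos hsX] at hcol
  exact fun s t hs ht => (hP s hs).trans (hP t ht).symm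

end KetonenSolovay

open KetonenSolovay in
theorem mainTheorem1_general (n m : ℕ) (X : Finset ℕ) (hm : 35 * n ≤ m)
    (hX : IsLarge (CNF.omegaPow m) X) : IsRTLarge 2 2 (CNF.omegaPow n) X := by
  intro P
  have hlarge : ContainsLarge [m] X := containsLarge_exps_iff.2 ⟨X, subset_rfl, hX⟩
  obtain ⟨b, Y, hYX, hY, hhom⟩ := hlarge.exists_increasingPairs (pairColor P) hm
  obtain ⟨W, hWY, hW⟩ := (containsLarge_exps_iff (α := CNF.omegaPow n)).1 hY
  exact ⟨W, hWY.trans hYX, (hhom.mono hWY).isHomogeneous, hW⟩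

theorem mainTheorem1 (n : ℕ) (X : Finset ℕ) (hmin : ∀ x ∈ X, 3 ≤ x)
    (hX : KetonenSolovay.IsLarge (KetonenSolovay.CNF.omegaPow (300 * n)) X) :
    KetonenSolovay.IsRTLarge 2 2 (KetonenSolovay.CNF.omegaPow n) X :=
  mainTheorem1_general n (300 * n) X (by omega) hX
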